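/- Let $E\subset\mathbb{R}^d$ be closed and unbounded, let $m$ be a non-negative Radon measure on $E$ with $m(O)\neq 0$ for every non-empty (relatively) open $O\subset E$, and let $(X(t))_{t\ge 0}$ be a strong Markov process on $E$ whose sample paths are right continuous with left limits; $\mathbb{P}_x$, $\mathbb{E}_x$ denote its law and expectation when started at $x$. For a closed set $V\subset E$ let $\tau(V)=\inf\{t>0: X(t)\in V\}$ ($\inf\emptyset=+\infty$). Assume that for every closed $V\subset E$ the time $\tau(V)$ is a random variable and that, for every bounded measurable $\varphi:E\to\mathbb{R}$, the map $(t,x)\mapsto\mathbb{E}_x\bigl(\varphi(X(t));\,\tau(V)>t\bigr)$ is jointly Borel measurable on $\mathbb{R}_+\times E$. Let $r^*_e$ be the infimum of all $r>0$ for which there is a compact set $K\subset E$ such that, for every compact set $W\subset E\setminus K$, the function $$x\mapsto\int_0^\infty r^{-t}\,\mathbb{P}_x\bigl(X(t)\in W,\ \tau(K)>t\bigr)\,dt$$ is $m$-integrable on the compact subsets of $E\setminus K$. Let $\sigma^*_e$ be the infimum of all $r>0$ for which there is a compact set $K\subset E$ such that the function $$x\mapsto\int_0^\infty r^{-t}\,\mathbb{P}_x\bigl(\tau(K)>t\bigr)\,dt$$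 is $m$-integrable on the compact subsets of $E\setminus K$. Suppose that there is an increasing sequence $(U_n)_{n\in\mathbb{N}}$ of open relatively compact subsets of $E$ with $\bigcup_n U_n=E$ such that, for every $n\in\mathbb{N}$, there is a non-negative continuous function $\varphi_n$ on $E$ with compact support contained in $E\setminus\overline{U}_n$ for which - for every $t>0$ the function $x\mapsto\mathbb{E}_x\bigl(\varphi_n(X(t));\,\tau(\overline{U}_n)>t\bigr)$ is continuous on $E\setminus\overline{U}_n$, and - for every $x\in E\setminus\overline{U}_n$ there is $t>0$ with $\mathbb{E}_x\bigl(\varphi_n(X(t));\,\tau(\overline{U}_n)>t\bigr)>0$. Suppose moreover that for every $n>0$ and every $x\in E\setminus\overline{U}_{n+1}$, $\mathbb{P}_x$-almost surely, $$\tau(\overline{U}_{n+1})<\tau(\overline{U}_n)<+\infty .$$ Then $r^*_e=\sigma^*_e$. -/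

import Mathlib

open MeasureTheory Filter Topology Set
open scoped NNReal ENNReal

noncomputable section

/-- A strong Markov process `(Ω, X_t, θ_t, P_x)` in continuous time with state space `S`,
all of whose sample paths are right continuous with left limits. -/
structure StrongMarkovProcess (Ω S : Type*) [MeasurableSpace Ω] [TopologicalSpace S]
    [TopologicalSpace.MetrizableSpace S] [SecondCountableTopology S]
    [MeasurableSpace S] [BorelSpace S] where
  /-- the position `X_t` at time `t` -/
  X : ℝ≥0 → Ω → S
  /-- the law `P_x` of the process started at `x` -/
  P : S → Measure Ω
  /-- the time shift `θ_t` -/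
  shift : ℝ≥0 → Ω → Ω
  measurable_X : ∀ t, Measurable (X t)
  isProbabilityMeasure_P : ∀ x, IsProbabilityMeasure (P x)
  /-- `P_x (X_0 = x) = 1` -/
  start : ∀ x, ∀ᵐ ω ∂(P x), X 0 ω = x
  rightContinuous : ∀ ω t, ContinuousWithinAt (fun s => X s ω) (Ici t) t
  leftLimits : ∀ ω t, ∃ l, Tendsto (fun s => X s ω) (𝓝[<] t) (𝓝 l)
  X_shift : ∀ s t ω, X s (shift t ω) = X (t + s) ω
  /-- The strong Markov property `E_x (F ∘ θ_T ; A) = E_x (E_{X_T} (F) ; A)` for every stopping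
  time `T` of the right-continuous filtration `(⋂ s > t, σ(X_u, u ≤ s))_t`, every event `A` in the
  stopped σ-algebra with `A ⊆ {T < ∞}`, and every non-negative measurable `F`. -/
  strongMarkov : ∀ (x : S) (T : Ω → WithTop ℝ≥0)
    (hT : IsStoppingTime
      (Filtration.natural X fun t => (measurable_X t).stronglyMeasurable).rightCont T)
    (A : Set Ω), MeasurableSet[hT.measurableSpace] A → (∀ ω ∈ A, T ω ≠ ⊤) →
    ∀ F : Ω → ℝ≥0∞, Measurable F →
      ∫⁻ ω in A, F (shift (T ω).untopA ω) ∂(P x) =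
        ∫⁻ ω in A, (∫⁻ ω', F ω' ∂(P (X (T ω).untopA ω))) ∂(P x)

namespace StrongMarkovProcess

variable {Ω S : Type*} [MeasurableSpace Ω] [TopologicalSpace S]
  [TopologicalSpace.MetrizableSpace S] [SecondCountableTopology S]
  [MeasurableSpace S] [BorelSpace S]

/-- The hitting time `τ(V) = inf {t > 0 : X_t ∈ V}`, equal to `∞` if there is no such `t`. -/
def hittingTime (M : StrongMarkovProcess Ω S) (V : Set S) (ω : Ω) : ℝ≥0∞ :=
  ⨅ (t : ℝ≥0) (_ : 0 < t ∧ M.X t ω ∈ V), (t : ℝ≥0∞)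

/-- The killed expectation `E_x (φ(X_t) ; τ(V) > t)`. -/
def killedExp (M : StrongMarkovProcess Ω S) (V : Set S) (φ : S → ℝ) (t : ℝ≥0) (x : S) : ℝ :=
  ∫ ω in {ω | (t : ℝ≥0∞) < M.hittingTime V ω}, φ (M.X t ω) ∂(M.P x)

/-- The hitting times of closed sets `V` are random variables, and
`(t, x) ↦ E_x (φ(X_t) ; τ(V) > t)` is jointly measurable for all bounded measurable `φ`. -/
structure MeasurableHitting (M : StrongMarkovProcess Ω S) : Prop where
  hittingTime : ∀ V : Set S, IsClosed V → Measurable (M.hittingTime V)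
  killedExp : ∀ V : Set S, IsClosed V → ∀ φ : S → ℝ, Measurable φ →
    (∃ C : ℝ, ∀ x, |φ x| ≤ C) →
    Measurable fun p : ℝ≥0 × S => M.killedExp V φ p.1 p.2

/-- The truncated resolvent function
`x ↦ ∫₀^∞ r^{-t} P_x (X_t ∈ W, τ(K) > t) dt`, with values in `[0, ∞]`. -/
def truncResolvent (M : StrongMarkovProcess Ω S) (K : Set S) (r : ℝ) (W : Set S) (x : S) : ℝ≥0∞ :=
  ∫⁻ t in Ioi (0 : ℝ), ENNReal.ofReal (r ^ (-t)) *
    M.P x {ω | M.X t.toNNReal ω ∈ W ∧ (t.toNNReal : ℝ≥0∞) < M.hittingTime K ω}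

/-- The function `x ↦ ∫₀^∞ r^{-t} P_x (τ(K) > t) dt`, with values in `[0, ∞]`. -/
def hittingResolvent (M : StrongMarkovProcess Ω S) (K : Set S) (r : ℝ) (x : S) : ℝ≥0∞ :=
  ∫⁻ t in Ioi (0 : ℝ), ENNReal.ofReal (r ^ (-t)) *
    M.P x {ω | (t.toNNReal : ℝ≥0∞) < M.hittingTime K ω}

end StrongMarkovProcess

/-- A `[0, ∞]`-valued function `f` is `m`-integrable on all compact subsets of `D`. -/
def IntegrableOnCompactsIn {S : Type*} [TopologicalSpace S] [MeasurableSpace S]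
    (m : Measure S) (D : Set S) (f : S → ℝ≥0∞) : Prop :=
  ∀ C : Set S, IsCompact C → C ⊆ D →
    AEMeasurable f (m.restrict C) ∧ ∫⁻ x in C, f x ∂m < ∞

namespace StrongMarkovProcess

variable {Ω S : Type*} [MeasurableSpace Ω] [TopologicalSpace S]
  [TopologicalSpace.MetrizableSpace S] [SecondCountableTopology S]
  [MeasurableSpace S] [BorelSpace S]

/-- The essential spectral radius `r*_e` of the process with respect to `m`. -/
def essentialSpectralRadius (M : StrongMarkovProcess Ω S) (m : Measure S) : ℝ :=
  sInf {r : ℝ | 0 < r ∧ ∃ K : Set S, IsCompact K ∧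
    ∀ W : Set S, IsCompact W → W ⊆ Kᶜ → IntegrableOnCompactsIn m Kᶜ (M.truncResolvent K r W)}

/-- The rate `σ*_e` of return to compact sets with respect to `m`. -/
def returnRate (M : StrongMarkovProcess Ω S) (m : Measure S) : ℝ :=
  sInf {r : ℝ | 0 < r ∧ ∃ K : Set S, IsCompact K ∧
    IntegrableOnCompactsIn m Kᶜ (M.hittingResolvent K r)}

end StrongMarkovProcess

end

/-! Integrability of the hitting resolvent implies that of every truncated one, and it holds for
every `r > 1`; only `r < 1` in the set defining `r*_e` needs work. Choose `n`, `k`, `j` with `K ⊆ U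
n`, `closure (U n) ⊆ U k` and `closure (U (k + 1)) ⊆ U j`. From outside `closure (U j)` the process
enters `U j` at a time `T` strictly before reaching `closure (U k)`, so it lands in the compact
shell `closure (U j) \ U k`. There the resolvent killed on `closure (U n)` is at least some `δ > 0`
(`exists_pos_le_truncResolvent`). The strong Markov property at `T` gives `δ P_x(T > t) ≤ E_x(r^T ·
occupation; T > t)`. Integrating against `r^{-t} dt` costs a factor `r^T ∫₀^T r^{-t} dt`, bounded
uniformly in `T` because `r < 1` (`mul_hittingResolvent_le`). -/

namespace StrongMarkovProcess

variable {Ω S : Type*} [MeasurableSpace Ω] [TopologicalSpace S]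
  [TopologicalSpace.MetrizableSpace S] [SecondCountableTopology S]
  [MeasurableSpace S] [BorelSpace S] (M : StrongMarkovProcess Ω S)

/-! ### Pathwise properties of hitting times -/

theorem hittingTime_lt_iff {V : Set S} {ω : Ω} {a : ℝ≥0∞} :
    M.hittingTime V ω < a ↔ ∃ t : ℝ≥0, 0 < t ∧ M.X t ω ∈ V ∧ (t : ℝ≥0∞) < a := by
  simp [hittingTime, iInf_lt_iff, and_assoc]

theorem hittingTime_le {V : Set S} {ω : Ω} {t : ℝ≥0} (ht : 0 < t) (h : M.X t ω ∈ V) :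
    M.hittingTime V ω ≤ t :=
  iInf₂_le t ⟨ht, h⟩

theorem hittingTime_anti {V V' : Set S} (h : V ⊆ V') (ω : Ω) :
    M.hittingTime V' ω ≤ M.hittingTime V ω :=
  le_iInf₂ fun _ ht => M.hittingTime_le ht.1 (h ht.2)

theorem X_notMem_of_lt_hittingTime {V : Set S} {ω : Ω} {t : ℝ≥0} (ht : 0 < t)
    (h : (t : ℝ≥0∞) < M.hittingTime V ω) : M.X t ω ∉ V := fun hV =>
  (M.hittingTime_le ht hV).not_gt h

/-- A path outside `closure V` at time `t` stays outside on some `[t, u)` by right continuity, so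
the infimum could not be `t`. -/
theorem X_mem_closure_of_hittingTime_eq {V : Set S} {ω : Ω} {t : ℝ≥0}
    (h : M.hittingTime V ω = t) : M.X t ω ∈ closure V := by
  by_contra hc
  have hev : ∀ᶠ s in 𝓝[≥] t, M.X s ω ∈ (closure V)ᶜ :=
    M.rightContinuous ω t (isClosed_closure.isOpen_compl.mem_nhds hc)
  obtain ⟨u, htu, hu⟩ := (mem_nhdsGE_iff_exists_Ico_subset' (lt_add_one t)).1 hev
  have hlt : M.hittingTime V ω < (u : ℝ≥0∞) := by
    rw [h]; exact_mod_cast htu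
  obtain ⟨s, hs0, hsV, hsu⟩ := M.hittingTime_lt_iff.1 hlt
  have hts : t ≤ s := by
    have := M.hittingTime_le hs0 hsV
    rw [h] at this; exact_mod_cast this
  exact hu ⟨hts, by exact_mod_cast hsu⟩ (subset_closure hsV)

theorem add_hittingTime_shift_le {V : Set S} {ω : Ω} {t : ℝ≥0}
    (h : (t : ℝ≥0∞) < M.hittingTime V ω) :
    t + M.hittingTime V (M.shift t ω) ≤ M.hittingTime V ω := by
  refine le_iInf₂ fun u hu => ?_
  have htu : t < u := by exact_mod_cast h.trans_le (M.hittingTime_le hu.1 hu.2)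
  have hX : M.X (u - t) (M.shift t ω) ∈ V := by
    rw [M.X_shift, add_tsub_cancel_of_le htu.le]; exact hu.2
  calc t + M.hittingTime V (M.shift t ω) ≤ t + ((u - t : ℝ≥0) : ℝ≥0∞) := by
        gcongr; exact M.hittingTime_le (tsub_pos_of_lt htu) hX
    _ = u := by
        rw [← ENNReal.coe_add, add_tsub_cancel_of_le htu.le]

/-! ### Joint measurability and stopping times -/

theorem exists_measurable_approx_right : ∃ (c : ℕ → ℕ → ℝ≥0) (κ : ℕ → ℝ≥0 → ℕ),
    (∀ n, Measurable (κ n)) ∧ ∀ t, Tendsto (fun n => c n (κ n t)) atTop (𝓝[≥] t) := by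
  refine ⟨fun n k => ((k : ℝ≥0) + 1) / (n + 1), fun n t => ⌊t * (n + 1)⌋₊,
    fun n => Nat.measurable_floor.comp (measurable_id.mul_const _), fun t => ?_⟩
  have hle : ∀ n : ℕ, t ≤ ((⌊t * (n + 1)⌋₊ : ℝ≥0) + 1) / (n + 1) := fun n => by
    rw [le_div_iff₀ (by positivity)]
    exact (Nat.lt_floor_add_one _).le
  refine tendsto_nhdsWithin_iff.2 ⟨?_, Eventually.of_forall fun n => hle n⟩
  have h0 : Tendsto (fun n : ℕ => t + 1 / ((n : ℝ≥0) + 1)) atTop (𝓝 t) := by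
    simpa using tendsto_const_nhds.add (tendsto_one_div_add_atTop_nhds_zero_nat (𝕜 := ℝ≥0))
  refine tendsto_of_tendsto_of_tendsto_of_le_of_le tendsto_const_nhds h0 hle fun n => ?_
  rw [div_le_iff₀ (by positivity), add_mul, one_div, inv_mul_cancel₀ (by positivity)]
  gcongr
  exact Nat.floor_le (zero_le)

/-- By right continuity, `(t, ω) ↦ X_t(ω)` is jointly measurable. -/
theorem measurable_uncurry_X : Measurable fun p : ℝ≥0 × Ω => M.X p.1 p.2 := by
  obtain ⟨c, κ, hκ, hc⟩ := exists_measurable_approx_right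
  refine measurable_of_tendsto_metrizable (f := fun n (p : ℝ≥0 × Ω) => M.X (c n (κ n p.1)) p.2)
    (fun n => ?_) (tendsto_pi_nhds.2 fun p => (M.rightContinuous p.2 p.1).tendsto.comp (hc p.1))
  have h1 : Measurable fun q : ℕ × Ω => M.X (c n q.1) q.2 :=
    measurable_from_prod_countable_right fun k => M.measurable_X (c n k)
  exact h1.comp (((hκ n).comp measurable_fst).prodMk measurable_snd)

/-- Hitting times of open sets are stopping times of the right-continuous filtration. -/
theorem isStoppingTime_hittingTime_of_isOpen {O : Set S} (hO : IsOpen O) :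
    IsStoppingTime (Filtration.natural M.X
      fun t => (M.measurable_X t).stronglyMeasurable).rightCont
      (fun ω => (M.hittingTime O ω : WithTop ℝ≥0)) := by
  refine isStoppingTime_of_measurableSet_lt_of_isRightContinuous fun t => ?_
  refine Filtration.le_rightCont _ t _ ?_
  obtain ⟨D, hDc, hDd⟩ := TopologicalSpace.exists_countable_dense ℝ≥0
  -- By right continuity a visit to `O` lasts for a short interval, which contains a time in the
  -- countable dense set `D`.
  have heq : {ω | (M.hittingTime O ω : WithTop ℝ≥0) < (t : WithTop ℝ≥0)} =
      ⋃ q ∈ D ∩ Ioo 0 t, M.X q ⁻¹' O := by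
    ext ω
    simp only [mem_ofPred_eq, mem_iUnion, mem_preimage, exists_prop]
    refine Iff.trans (M.hittingTime_lt_iff (a := (t : ℝ≥0∞))) ⟨?_, ?_⟩
    · rintro ⟨s, hs0, hsO, hst⟩
      have hst' : s < t := by exact_mod_cast hst
      have hev : ∀ᶠ u in 𝓝[≥] s, M.X u ω ∈ O := M.rightContinuous ω s (hO.mem_nhds hsO)
      obtain ⟨u, hsu, hu⟩ := (mem_nhdsGE_iff_exists_Ico_subset' hst').1 hev
      obtain ⟨q, hqD, hq⟩ := hDd.exists_between (lt_min hsu hst')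
      exact ⟨q, ⟨hqD, hs0.trans hq.1, hq.2.trans_le (min_le_right _ _)⟩,
        hu ⟨hq.1.le, hq.2.trans_le (min_le_left _ _)⟩⟩
    · rintro ⟨q, ⟨-, hq0, hqt⟩, hqO⟩
      exact ⟨q, hq0, hqO, by exact_mod_cast hqt⟩
  refine heq ▸ MeasurableSet.biUnion (hDc.mono inter_subset_left) fun q hq => ?_
  exact ((Filtration.stronglyAdapted_natural
    fun t => (M.measurable_X t).stronglyMeasurable) q).measurable.mono
      (Filtration.mono _ hq.2.2.le) le_rfl hO.measurableSet

/-! ### Discounted occupation times and resolvents -/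

/-- The discounted time spent in `W` before hitting `V`. -/
noncomputable def occupation (V : Set S) (r : ℝ) (W : Set S) (ω : Ω) : ℝ≥0∞ :=
  ∫⁻ t in Ioi (0 : ℝ), ENNReal.ofReal (r ^ (-t)) *
    {ω | M.X t.toNNReal ω ∈ W ∧ (t.toNNReal : ℝ≥0∞) < M.hittingTime V ω}.indicator 1 ω

variable {M}

theorem measurable_rpow_neg (r : ℝ) : Measurable fun t : ℝ => ENNReal.ofReal (r ^ (-t)) :=
  ENNReal.measurable_ofReal.comp (measurable_const.pow measurable_neg)

theorem MeasurableHitting.measurableSet_killed (hM : M.MeasurableHitting) {V W : Set S}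
    (hV : IsClosed V) (hW : MeasurableSet W) :
    MeasurableSet {p : ℝ × Ω | M.X p.1.toNNReal p.2 ∈ W ∧
      (p.1.toNNReal : ℝ≥0∞) < M.hittingTime V p.2} := by
  have h1 : Measurable fun p : ℝ × Ω => p.1.toNNReal := measurable_fst.real_toNNReal
  refine MeasurableSet.inter ?_ ?_
  · exact (M.measurable_uncurry_X.comp (h1.prodMk measurable_snd)) hW
  · exact measurableSet_lt h1.coe_nnreal_ennreal ((hM.hittingTime V hV).comp measurable_snd)

theorem MeasurableHitting.measurable_uncurry_occupation (hM : M.MeasurableHitting) {V W : Set S}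
    (hV : IsClosed V) (hW : MeasurableSet W) (r : ℝ) :
    Measurable fun p : Ω × ℝ => ENNReal.ofReal (r ^ (-p.2)) *
      {ω | M.X p.2.toNNReal ω ∈ W ∧ (p.2.toNNReal : ℝ≥0∞) < M.hittingTime V ω}.indicator 1 p.1 := by
  refine ((measurable_rpow_neg r).comp measurable_snd).mul ?_
  exact (measurable_one.indicator (hM.measurableSet_killed hV hW)).comp measurable_swap

theorem MeasurableHitting.measurable_occupation (hM : M.MeasurableHitting) {V W : Set S}
    (hV : IsClosed V) (hW : MeasurableSet W) (r : ℝ) : Measurable (M.occupation V r W) :=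
  (hM.measurable_uncurry_occupation hV hW r).lintegral_prod_right'

theorem MeasurableHitting.measurableSet_killed_right (hM : M.MeasurableHitting) {V W : Set S}
    (hV : IsClosed V) (hW : MeasurableSet W) (t : ℝ≥0) :
    MeasurableSet {ω | M.X t ω ∈ W ∧ (t : ℝ≥0∞) < M.hittingTime V ω} :=
  (M.measurable_X t hW).inter (measurableSet_lt measurable_const (hM.hittingTime V hV))

theorem MeasurableHitting.lintegral_occupation (hM : M.MeasurableHitting) {V W : Set S}
    (hV : IsClosed V) (hW : MeasurableSet W) (r : ℝ) (x : S) :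
    ∫⁻ ω, M.occupation V r W ω ∂(M.P x) = M.truncResolvent V r W x := by
  have := M.isProbabilityMeasure_P x
  unfold occupation truncResolvent
  rw [lintegral_lintegral_swap (hM.measurable_uncurry_occupation hV hW r).aemeasurable]
  refine lintegral_congr fun t => ?_
  have hs := hM.measurableSet_killed_right hV hW t.toNNReal
  rw [lintegral_const_mul _ (measurable_one.indicator hs), lintegral_indicator_one hs]

theorem MeasurableHitting.measurable_truncResolvent (hM : M.MeasurableHitting) {V W : Set S}
    (hV : IsClosed V) (hW : MeasurableSet W) (r : ℝ) : Measurable (M.truncResolvent V r W) := by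
  have h := hM.killedExp V hV (W.indicator 1) (measurable_one.indicator hW)
    ⟨1, fun x => by by_cases hx : x ∈ W <;> simp [hx]⟩
  have heq : ∀ (t : ℝ≥0) (x : S), M.P x {ω | M.X t ω ∈ W ∧ (t : ℝ≥0∞) < M.hittingTime V ω} =
      ENNReal.ofReal (M.killedExp V (W.indicator 1) t x) := fun t x => by
    have := M.isProbabilityMeasure_P x
    have h1 : (fun ω => W.indicator (1 : S → ℝ) (M.X t ω)) = (M.X t ⁻¹' W).indicator 1 := rfl
    rw [StrongMarkovProcess.killedExp, h1, integral_indicator_one (M.measurable_X t hW), measureReal_def,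
      ENNReal.ofReal_toReal (measure_ne_top _ _), Measure.restrict_apply (M.measurable_X t hW)]
    rfl
  unfold truncResolvent
  simp_rw [heq]
  refine Measurable.lintegral_prod_right' (f := fun p : S × ℝ => ENNReal.ofReal (r ^ (-p.2)) *
    ENNReal.ofReal (M.killedExp V (W.indicator 1) p.2.toNNReal p.1)) ?_
  refine ((measurable_rpow_neg r).comp measurable_snd).mul (ENNReal.measurable_ofReal.comp ?_)
  exact h.comp (measurable_snd.real_toNNReal.prodMk measurable_fst)

theorem hittingResolvent_eq (V : Set S) (r : ℝ) :
    M.hittingResolvent V r = M.truncResolvent V r univ := by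
  funext x; simp [hittingResolvent, truncResolvent]

theorem truncResolvent_mono {V V' W W' : Set S} (hV : V' ⊆ V) (hW : W ⊆ W') (r : ℝ) (x : S) :
    M.truncResolvent V r W x ≤ M.truncResolvent V' r W' x := by
  unfold truncResolvent
  refine lintegral_mono fun t => mul_le_mul_right (measure_mono fun ω h => ?_) _
  exact ⟨hW h.1, h.2.trans_le (M.hittingTime_anti hV ω)⟩

/-- The shifted path only sees the occupation after time `t`, and its weight is `r^{-s} = r^t
r^{-(s+t)}`. -/
theorem occupation_shift_le {V W : Set S} {r : ℝ} (hr : 0 < r) {ω : Ω} {t : ℝ≥0}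
    (h : (t : ℝ≥0∞) < M.hittingTime V ω) :
    M.occupation V r W (M.shift t ω) ≤ ENNReal.ofReal (r ^ (t : ℝ)) * M.occupation V r W ω := by
  let g : ℝ → ℝ≥0∞ := fun s => ENNReal.ofReal (r ^ (-s)) *
    {ω | M.X s.toNNReal ω ∈ W ∧ (s.toNNReal : ℝ≥0∞) < M.hittingTime V ω}.indicator 1 ω
  have hocc : M.occupation V r W ω = ∫⁻ s, (Ioi (0 : ℝ)).indicator g (s + t) := by
    rw [lintegral_add_right_eq_self, lintegral_indicator measurableSet_Ioi]; rfl
  rw [hocc, ← lintegral_const_mul' _ _ ENNReal.ofReal_ne_top, occupation,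
    ← lintegral_indicator measurableSet_Ioi]
  refine lintegral_mono fun s => ?_
  by_cases hs0 : 0 < s
  swap
  · rw [indicator_of_notMem (by exact hs0)]; exact zero_le
  rw [indicator_of_mem (show s ∈ Ioi (0 : ℝ) from hs0),
    indicator_of_mem (show s + t ∈ Ioi (0 : ℝ) from add_pos_of_pos_of_nonneg hs0 t.2), ← mul_assoc,
    ← ENNReal.ofReal_mul (by positivity), ← Real.rpow_add hr,
    show (t : ℝ) + -(s + t) = -s by ring]
  have hn : (s + t).toNNReal = t + s.toNNReal := by
    rw [Real.toNNReal_add hs0.le t.coe_nonneg, Real.toNNReal_coe, add_comm]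
  refine mul_le_mul_right ?_ _
  by_cases hη : M.X s.toNNReal (M.shift t ω) ∈ W ∧
      (s.toNNReal : ℝ≥0∞) < M.hittingTime V (M.shift t ω)
  · have hmem : M.X (s + t).toNNReal ω ∈ W ∧ ((s + t).toNNReal : ℝ≥0∞) < M.hittingTime V ω := by
      rw [hn, ← M.X_shift]
      refine ⟨hη.1, lt_of_lt_of_le ?_ (M.add_hittingTime_shift_le h)⟩
      rw [ENNReal.coe_add]
      exact ENNReal.add_lt_add_left ENNReal.coe_ne_top hη.2
    rw [indicator_of_mem (by exact hη), indicator_of_mem (by exact hmem)]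
    exact le_rfl
  · rw [indicator_of_notMem (by exact hη)]
    exact zero_le

end StrongMarkovProcess

/-! ### Exponential integrals -/

theorem lintegral_rpow_neg_Ioi_lt_top {r : ℝ} (hr : 1 < r) :
    ∫⁻ t in Ioi (0 : ℝ), ENNReal.ofReal (r ^ (-t)) < ∞ := by
  have h := exp_neg_integrableOn_Ioi 0 (Real.log_pos hr)
  refine lt_of_eq_of_lt (lintegral_congr fun t => ?_) h.setLIntegral_lt_top
  rw [Real.rpow_def_of_pos (by linarith)]
  congr 2; ring

theorem lintegral_rpow_neg_Iio_lt_top {r : ℝ} (hr0 : 0 < r) (hr : r < 1) :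
    ∫⁻ t in Iio (0 : ℝ), ENNReal.ofReal (r ^ (-t)) < ∞ := by
  have h := (integrableOn_exp_mul_Iic (neg_pos.2 (Real.log_neg hr0 hr)) 0).mono_set
    Iio_subset_Iic_self
  refine lt_of_eq_of_lt (lintegral_congr fun t => ?_) h.setLIntegral_lt_top
  rw [Real.rpow_def_of_pos hr0]
  congr 2; ring

/-- Substituting `t - a` for `t` turns the left side into an integral over part of the negative
half-line, whence a bound free of `a`. -/
theorem lintegral_rpow_sub_le {r : ℝ} (hr : 0 < r) (a : ℝ) :
    ENNReal.ofReal (r ^ a) * ∫⁻ t in Ioi (0 : ℝ), (Iio a).indicator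
      (fun t => ENNReal.ofReal (r ^ (-t))) t ≤ ∫⁻ t in Iio (0 : ℝ), ENNReal.ofReal (r ^ (-t)) := by
  rw [← lintegral_indicator measurableSet_Iio,
    ← lintegral_sub_right_eq_self ((Iio (0 : ℝ)).indicator _) a,
    ← lintegral_const_mul' _ _ ENNReal.ofReal_ne_top]
  refine (setLIntegral_le_lintegral _ _).trans (lintegral_mono fun t => ?_)
  by_cases ht : t < a
  · rw [indicator_of_mem (show t ∈ Iio a from ht),
      indicator_of_mem (show t - a ∈ Iio (0 : ℝ) from sub_neg.2 ht),
      ← ENNReal.ofReal_mul (by positivity), ← Real.rpow_add hr]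
    exact le_of_eq (by congr 2; ring)
  · rw [indicator_of_notMem (by exact ht), mul_zero]; exact zero_le

/-! ### Lower bound on compacts and the strong Markov estimate -/

namespace StrongMarkovProcess

variable {Ω S : Type*} [MeasurableSpace Ω] [TopologicalSpace S]
  [TopologicalSpace.MetrizableSpace S] [SecondCountableTopology S]
  [MeasurableSpace S] [BorelSpace S] {M : StrongMarkovProcess Ω S}

/-- The killed semigroup is right continuous in time. -/
theorem MeasurableHitting.continuousWithinAt_killedExp (hM : M.MeasurableHitting) {V : Set S}
    (hV : IsClosed V) {φ : S → ℝ} (hφ : Continuous φ) {C : ℝ} (hC : ∀ x, |φ x| ≤ C)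
    (x : S) (t : ℝ≥0) :
    ContinuousWithinAt (fun s => M.killedExp V φ s x) (Ici t) t := by
  have := M.isProbabilityMeasure_P x
  have hs : ∀ s : ℝ≥0, MeasurableSet {ω | (s : ℝ≥0∞) < M.hittingTime V ω} := fun s =>
    measurableSet_lt measurable_const (hM.hittingTime V hV)
  have heq : ∀ s : ℝ≥0, M.killedExp V φ s x =
      ∫ ω, {ω | (s : ℝ≥0∞) < M.hittingTime V ω}.indicator (fun ω => φ (M.X s ω)) ω ∂(M.P x) :=
    fun s => (integral_indicator (hs s)).symm
  unfold ContinuousWithinAt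
  simp_rw [heq]
  refine tendsto_integral_filter_of_dominated_convergence (fun _ => C) ?_ ?_
    (integrable_const C) ?_
  · exact Eventually.of_forall fun s =>
      ((hφ.measurable.comp (M.measurable_X s)).indicator (hs s)).aestronglyMeasurable
  · refine Eventually.of_forall fun s => Eventually.of_forall fun ω => ?_
    exact (norm_indicator_le_norm_self _ _).trans (hC _)
  · refine Eventually.of_forall fun ω => ?_
    -- Survival at `t` persists slightly beyond `t`; death by time `t` persists at all later times.
    by_cases ht : (t : ℝ≥0∞) < M.hittingTime V ω
    · have hev : ∀ᶠ s : ℝ≥0 in 𝓝[≥] t, (s : ℝ≥0∞) < M.hittingTime V ω :=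
        ((ENNReal.continuous_coe.tendsto t).mono_left nhdsWithin_le_nhds).eventually_lt_const ht
      rw [indicator_of_mem (by exact ht)]
      refine ((hφ.tendsto _).comp (M.rightContinuous ω t).tendsto).congr' ?_
      filter_upwards [hev] with s hs'
      rw [indicator_of_mem (by exact hs')]; rfl
    · rw [indicator_of_notMem (by exact ht)]
      refine tendsto_const_nhds.congr' ?_
      filter_upwards [self_mem_nhdsWithin] with s hs'
      rw [indicator_of_notMem]
      exact fun h => ht ((ENNReal.coe_le_coe.2 hs').trans_lt h)

theorem ofReal_killedExp_le {V : Set S} {φ : S → ℝ} (hφ : Continuous φ) (h0 : ∀ x, 0 ≤ φ x) {C : ℝ}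
    (hC : ∀ x, |φ x| ≤ C) (x : S) (t : ℝ≥0) :
    ENNReal.ofReal (M.killedExp V φ t x) ≤ ENNReal.ofReal C *
      M.P x {ω | M.X t ω ∈ tsupport φ ∧ (t : ℝ≥0∞) < M.hittingTime V ω} := by
  have := M.isProbabilityMeasure_P x
  have hφX : Measurable fun ω => φ (M.X t ω) := hφ.measurable.comp (M.measurable_X t)
  have hW : MeasurableSet (M.X t ⁻¹' tsupport φ) :=
    M.measurable_X t (isClosed_tsupport φ).measurableSet
  have hint : Integrable (fun ω => φ (M.X t ω))
      ((M.P x).restrict {ω | (t : ℝ≥0∞) < M.hittingTime V ω}) :=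
    Integrable.of_bound hφX.aestronglyMeasurable C (Eventually.of_forall fun ω => hC _)
  rw [killedExp, ofReal_integral_eq_lintegral_ofReal hint (Eventually.of_forall fun ω => h0 _)]
  calc _ ≤ ∫⁻ ω in {ω | (t : ℝ≥0∞) < M.hittingTime V ω},
        (M.X t ⁻¹' tsupport φ).indicator (fun _ => ENNReal.ofReal C) ω ∂(M.P x) := by
        refine lintegral_mono fun ω => ?_
        by_cases hω : M.X t ω ∈ tsupport φ
        · rw [indicator_of_mem (by exact hω)]
          exact ENNReal.ofReal_le_ofReal ((le_abs_self _).trans (hC _))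
        · simp [image_eq_zero_of_notMem_tsupport hω]
    _ = _ := by
        rw [lintegral_indicator_const hW, Measure.restrict_apply hW]; rfl

/-- The truncated resolvent is bounded below on compact subsets of the region where the killed
semigroup is continuous and charges `φ`. -/
theorem MeasurableHitting.exists_pos_le_truncResolvent (hM : M.MeasurableHitting) {V : Set S}
    (hV : IsClosed V) {φ : S → ℝ} (hφ : Continuous φ) (h0 : ∀ x, 0 ≤ φ x) {C : ℝ}
    (hC : ∀ x, |φ x| ≤ C)
    (hcont : ∀ t : ℝ≥0, 0 < t → ContinuousOn (fun x => M.killedExp V φ t x) Vᶜ)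
    (hpos : ∀ x ∈ Vᶜ, ∃ t : ℝ≥0, 0 < t ∧ 0 < M.killedExp V φ t x)
    {r : ℝ} (hr : 0 < r) {B : Set S} (hB : IsCompact B) (hBV : B ⊆ Vᶜ) :
    ∃ δ : ℝ≥0∞, δ ≠ 0 ∧ δ ≠ ∞ ∧ ∀ y ∈ B, δ ≤ M.truncResolvent V r (tsupport φ) y := by
  -- Otherwise the resolvent tends to `0` along a sequence in `B` converging to some `z ∈ B`.
  by_contra! hcon
  have hex : ∀ n : ℕ, ∃ y ∈ B,
      M.truncResolvent V r (tsupport φ) y < ((n : ℝ≥0∞) + 1)⁻¹ := fun n =>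
    hcon _ (by simp) (by simp)
  choose y hyB hy using hex
  let := TopologicalSpace.metrizableSpaceMetric S
  obtain ⟨z, hzB, k, hk, hz⟩ := hB.tendsto_subseq hyB
  let g : S → ℝ → ℝ≥0∞ := fun x t => ENNReal.ofReal (r ^ (-t)) *
    ENNReal.ofReal (M.killedExp V φ t.toNNReal x)
  have hgm : ∀ x, Measurable (g x) := fun x => by
    refine (measurable_rpow_neg r).mul (ENNReal.measurable_ofReal.comp ?_)
    exact (hM.killedExp V hV φ hφ.measurable ⟨C, hC⟩).comp
      (measurable_real_toNNReal.prodMk measurable_const)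
  have hgle : ∀ x, ∫⁻ t in Ioi (0 : ℝ), g x t ≤
      ENNReal.ofReal C * M.truncResolvent V r (tsupport φ) x := fun x => by
    rw [truncResolvent, ← lintegral_const_mul' _ _ ENNReal.ofReal_ne_top]
    refine lintegral_mono fun t => ?_
    rw [mul_left_comm]
    exact mul_le_mul_right (ofReal_killedExp_le hφ h0 hC x t.toNNReal) _
  have hlim0 : Tendsto (fun n => ∫⁻ t in Ioi (0 : ℝ), g (y (k n)) t) atTop (𝓝 0) := by
    have h1 : Tendsto (fun n : ℕ => ENNReal.ofReal C * ((n : ℝ≥0∞) + 1)⁻¹) atTop (𝓝 0) := by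
      have h2 : Tendsto (fun n : ℕ => ((n : ℝ≥0∞) + 1)⁻¹) atTop (𝓝 0) := by
        refine ((tendsto_add_atTop_iff_nat 1).2 ENNReal.tendsto_inv_nat_nhds_zero).congr
          fun n => ?_
        push_cast; rfl
      simpa using ENNReal.Tendsto.const_mul h2 (Or.inr ENNReal.ofReal_ne_top)
    refine tendsto_of_tendsto_of_tendsto_of_le_of_le tendsto_const_nhds
      (h1.comp hk.tendsto_atTop) (fun _ => zero_le) fun n => ?_
    exact (hgle _).trans (mul_le_mul_right (hy _).le _)
  -- Fatou's lemma, with continuity of the killed semigroup in space, carries the vanishing to `z`.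
  have hgz : ∫⁻ t in Ioi (0 : ℝ), g z t = 0 := by
    refine le_antisymm ?_ zero_le
    calc ∫⁻ t in Ioi (0 : ℝ), g z t
        = ∫⁻ t in Ioi (0 : ℝ), liminf (fun n => g (y (k n)) t) atTop := by
          refine setLIntegral_congr_fun measurableSet_Ioi fun t ht => ?_
          have hc : ContinuousAt (fun x => M.killedExp V φ t.toNNReal x) z :=
            (hcont t.toNNReal (Real.toNNReal_pos.2 ht)).continuousAt
              (hV.isOpen_compl.mem_nhds (hBV hzB))
          exact (Tendsto.liminf_eq (ENNReal.Tendsto.const_mul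
            (ENNReal.tendsto_ofReal (hc.tendsto.comp hz)) (Or.inr ENNReal.ofReal_ne_top))).symm
      _ ≤ liminf (fun n => ∫⁻ t in Ioi (0 : ℝ), g (y (k n)) t) atTop :=
          lintegral_liminf_le' fun n => (hgm _).aemeasurable
      _ = 0 := hlim0.liminf_eq
  obtain ⟨t₀, ht₀, hp⟩ := hpos z (hBV hzB)
  -- Right continuity in time spreads positivity at `t₀` over an interval of positive length,
  -- contradicting the zero integral.
  have hev : ∀ᶠ s in 𝓝[≥] t₀, 0 < M.killedExp V φ s z :=
    (hM.continuousWithinAt_killedExp hV hφ hC z t₀).eventually_const_lt hp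
  obtain ⟨u, htu, hu⟩ := (mem_nhdsGE_iff_exists_Ico_subset' (lt_add_one t₀)).1 hev
  rw [lintegral_eq_zero_iff (hgm z)] at hgz
  have hgz' := (ae_restrict_iff' measurableSet_Ioi).1 hgz
  have hnull : volume (Ioo (t₀ : ℝ) u) = 0 := by
    refine measure_mono_null (fun t ht => ?_) hgz'
    have ht0 : 0 < t := t₀.coe_nonneg.trans_lt ht.1
    have hmem : t.toNNReal ∈ Ico t₀ u :=
      ⟨NNReal.le_toNNReal_of_coe_le ht.1.le, (Real.toNNReal_lt_iff_lt_coe ht0.le).2 ht.2⟩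
    have hgt : g z t ≠ 0 :=
      mul_ne_zero (ENNReal.ofReal_pos.2 (Real.rpow_pos_of_pos hr _)).ne'
        (ENNReal.ofReal_pos.2 (hu hmem)).ne'
    exact fun h => hgt (h ht0)
  rw [Real.volume_Ioo, ENNReal.ofReal_eq_zero, sub_nonpos] at hnull
  exact htu.not_ge (by exact_mod_cast hnull)

/-- If the process hits the open set `O` strictly before `V`, at a place where the truncated
resolvent is at least `δ`, then the truncated resolvent controls the discounted integral of
the tail of the hitting time of `O`. -/
theorem MeasurableHitting.mul_hittingResolvent_le (hM : M.MeasurableHitting) {V W O : Set S}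
    (hV : IsClosed V) (hW : MeasurableSet W) (hO : IsOpen O) {r : ℝ} (hr : 0 < r)
    {δ : ℝ≥0∞} (hδt : δ ≠ ∞) {x : S}
    (hlt : ∀ᵐ ω ∂(M.P x), M.hittingTime O ω < M.hittingTime V ω)
    (hδ : ∀ᵐ ω ∂(M.P x), ∀ t : ℝ≥0, M.hittingTime O ω = t →
      δ ≤ M.truncResolvent V r W (M.X t ω)) :
    δ * M.hittingResolvent O r x ≤
      (∫⁻ t in Iio (0 : ℝ), ENNReal.ofReal (r ^ (-t))) * M.truncResolvent V r W x := by
  have := M.isProbabilityMeasure_P x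
  let T : Ω → WithTop ℝ≥0 := fun ω => M.hittingTime O ω
  have hT := M.isStoppingTime_hittingTime_of_isOpen hO
  -- `hM` covers closed sets only; for the open set `O` measurability comes from the stopping time
  -- property.
  have hTm : Measurable (M.hittingTime O) := by
    refine measurable_of_Ioi fun a => ?_
    induction a with
    | top => simp
    | coe a => exact hT.measurableSpace_le _ (hT.measurableSet_gt' a)
  have hF := hM.measurable_occupation hV hW r
  have key : ∀ t : ℝ≥0, δ * M.P x {ω | (t : ℝ≥0∞) < M.hittingTime O ω} ≤
      ∫⁻ ω in {ω | (t : ℝ≥0∞) < M.hittingTime O ω},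
        ENNReal.ofReal (r ^ (M.hittingTime O ω).toReal) * M.occupation V r W ω ∂(M.P x) := by
    intro t
    -- The strong Markov property needs `T < ∞` on the event; removing `T = ⊤` changes only a null
    -- set, by `hlt`.
    let A : Set Ω := {ω | (t : WithTop ℝ≥0) < T ω} ∩ {ω | T ω = ⊤}ᶜ
    have hA : MeasurableSet[hT.measurableSpace] A :=
      (hT.measurableSet_gt' t).inter ((measurableSet_singleton _).preimage hT.measurable).compl
    have hAm : MeasurableSet A := hT.measurableSpace_le _ hA
    have hSM := M.strongMarkov x T hT A hA (fun ω hω => hω.2) _ hF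
    have hAeq : A =ᵐ[M.P x] {ω | (t : ℝ≥0∞) < M.hittingTime O ω} := by
      filter_upwards [hlt] with ω hω
      exact propext ⟨fun h => h.1, fun h => ⟨h, (hω.trans_le le_top).ne⟩⟩
    rw [← measure_congr hAeq, ← setLIntegral_const, ← setLIntegral_congr hAeq]
    simp_rw [hM.lintegral_occupation hV hW] at hSM
    refine le_trans (setLIntegral_mono_ae' hAm ?_) (hSM.ge.trans (setLIntegral_mono_ae' hAm ?_))
    · filter_upwards [hδ] with ω hω hωA
      refine hω _ ?_
      exact (WithTop.untopA_eq_untop hωA.2 ▸ WithTop.coe_untop _ _).symm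
    · filter_upwards [hlt] with ω hω hωA
      have hu : M.hittingTime O ω = ((T ω).untopA : ℝ≥0) := (WithTop.untopA_eq_untop hωA.2 ▸ WithTop.coe_untop _ _).symm
      have := occupation_shift_le (W := W) hr (hu ▸ hω)
      refine this.trans_eq ?_
      rw [hu]; rfl
  let c := ∫⁻ t in Iio (0 : ℝ), ENNReal.ofReal (r ^ (-t))
  let G : Ω → ℝ≥0∞ := fun ω =>
    ENNReal.ofReal (r ^ (M.hittingTime O ω).toReal) * M.occupation V r W ω
  have hG : Measurable G :=
    (ENNReal.measurable_ofReal.comp (measurable_const.pow hTm.ennreal_toReal)).mul hF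
  have hset : MeasurableSet {p : ℝ × Ω | (p.1.toNNReal : ℝ≥0∞) < M.hittingTime O p.2} :=
    measurableSet_lt measurable_fst.real_toNNReal.coe_nnreal_ennreal (hTm.comp measurable_snd)
  calc δ * M.hittingResolvent O r x
      ≤ ∫⁻ t in Ioi (0 : ℝ), ENNReal.ofReal (r ^ (-t)) *
          (δ * M.P x {ω | (t.toNNReal : ℝ≥0∞) < M.hittingTime O ω}) := by
        rw [hittingResolvent, ← lintegral_const_mul' _ _ hδt]
        exact lintegral_mono fun t => (mul_left_comm _ _ _).le
    _ ≤ ∫⁻ t in Ioi (0 : ℝ), ∫⁻ ω, ENNReal.ofReal (r ^ (-t)) *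
          {ω | (t.toNNReal : ℝ≥0∞) < M.hittingTime O ω}.indicator G ω ∂(M.P x) := by
        refine lintegral_mono fun t => ?_
        rw [lintegral_const_mul' _ _ ENNReal.ofReal_ne_top,
          lintegral_indicator (measurableSet_lt measurable_const hTm)]
        exact mul_le_mul_right (key t.toNNReal) _
    _ = ∫⁻ ω, (∫⁻ t in Ioi (0 : ℝ), ENNReal.ofReal (r ^ (-t)) *
          {ω | (t.toNNReal : ℝ≥0∞) < M.hittingTime O ω}.indicator G ω) ∂(M.P x) := by
        refine lintegral_lintegral_swap (Measurable.aemeasurable ?_)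
        refine ((measurable_rpow_neg r).comp measurable_fst).mul ?_
        exact (hG.comp measurable_snd).indicator hset
    _ ≤ ∫⁻ ω, c * M.occupation V r W ω ∂(M.P x) := by
        refine lintegral_mono_ae ?_
        filter_upwards [hlt] with ω hω
        have hTt : M.hittingTime O ω ≠ ∞ := (hω.trans_le le_top).ne
        -- For fixed `ω` the time integral runs over `t < T`, so the factor `r^T` is absorbed by
        -- `lintegral_rpow_sub_le`.
        refine le_trans ?_ (mul_le_mul_left
          (lintegral_rpow_sub_le hr (M.hittingTime O ω).toReal) (M.occupation V r W ω))
        rw [mul_right_comm, mul_comm, ← lintegral_mul_const]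
        · refine setLIntegral_mono' measurableSet_Ioi fun t ht => ?_
          by_cases h : (t.toNNReal : ℝ≥0∞) < M.hittingTime O ω
          · rw [indicator_of_mem (by exact h), indicator_of_mem]
            exact (ENNReal.ofReal_lt_iff_lt_toReal (le_of_lt ht) hTt).1 h
          · rw [indicator_of_notMem (by exact h), mul_zero]; exact zero_le
        · exact (measurable_rpow_neg r).indicator measurableSet_Iio
    _ = c * M.truncResolvent V r W x := by
        rw [lintegral_const_mul _ hF, hM.lintegral_occupation hV hW]

end StrongMarkovProcess

/-! ### Comparison of the two rates -/

theorem exists_ge_subset_of_isCompact {S : Type*} [TopologicalSpace S] {U : ℕ → Set S}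
    (hU_mono : Monotone U) (hU_open : ∀ n, IsOpen (U n)) (hU_cover : ⋃ n, U n = univ)
    {K : Set S} (hK : IsCompact K) (N : ℕ) : ∃ n, N ≤ n ∧ K ⊆ U n := by
  obtain ⟨n, hn⟩ := hK.elim_directed_cover U hU_open (by simp [hU_cover])
    (directed_of_isDirected_le fun _ _ h => hU_mono h)
  exact ⟨max N n, le_max_left _ _, hn.trans (hU_mono (le_max_right _ _))⟩

namespace StrongMarkovProcess

variable {Ω S : Type*} [MeasurableSpace Ω] [TopologicalSpace S]
  [TopologicalSpace.MetrizableSpace S] [SecondCountableTopology S]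
  [MeasurableSpace S] [BorelSpace S] {M : StrongMarkovProcess Ω S}

theorem MeasurableHitting.integrableOnCompactsIn_hittingResolvent_of_one_lt
    (hM : M.MeasurableHitting) (m : Measure S) [IsFiniteMeasureOnCompacts m]
    {K : Set S} (hK : IsClosed K) {r : ℝ} (hr : 1 < r) (D : Set S) :
    IntegrableOnCompactsIn m D (M.hittingResolvent K r) := by
  intro C hC _
  have hmeas : Measurable (M.hittingResolvent K r) := by
    rw [hittingResolvent_eq]; exact hM.measurable_truncResolvent hK .univ r
  refine ⟨hmeas.aemeasurable, ?_⟩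
  have hle : ∀ x, M.hittingResolvent K r x ≤ ∫⁻ t in Ioi (0 : ℝ), ENNReal.ofReal (r ^ (-t)) :=
    fun x => by
      have := M.isProbabilityMeasure_P x
      exact lintegral_mono fun t => mul_le_of_le_one_right' prob_le_one
  refine (lintegral_mono hle).trans_lt ?_
  rw [setLIntegral_const]
  exact ENNReal.mul_lt_top (lintegral_rpow_neg_Ioi_lt_top hr) hC.measure_lt_top

theorem MeasurableHitting.integrableOnCompactsIn_truncResolvent (hM : M.MeasurableHitting)
    {m : Measure S} {K W D : Set S} (hK : IsClosed K) (hW : MeasurableSet W) {r : ℝ}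
    (h : IntegrableOnCompactsIn m D (M.hittingResolvent K r)) :
    IntegrableOnCompactsIn m D (M.truncResolvent K r W) := fun C hC hCD =>
  ⟨(hM.measurable_truncResolvent hK hW r).aemeasurable, (lintegral_mono fun x => by
    rw [hittingResolvent_eq]
    exact truncResolvent_mono subset_rfl (subset_univ W) r x).trans_lt (h C hC hCD).2⟩

/-- For `r < 1`, integrability of the truncated resolvents outside a compact set passes to the
hitting resolvent outside a larger compact set. -/
theorem MeasurableHitting.exists_integrableOnCompactsIn_hittingResolvent
    (hM : M.MeasurableHitting) (m : Measure S)
    (U : ℕ → Set S) (hU_mono : Monotone U) (hU_open : ∀ n, IsOpen (U n))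
    (hU_compact : ∀ n, IsCompact (closure (U n))) (hU_cover : ⋃ n, U n = univ)
    (hφ : ∀ n, ∃ φ : S → ℝ, Continuous φ ∧ (∀ x, 0 ≤ φ x) ∧
      HasCompactSupport φ ∧ tsupport φ ⊆ (closure (U n))ᶜ ∧
      (∀ t : ℝ≥0, 0 < t →
        ContinuousOn (fun x => M.killedExp (closure (U n)) φ t x) (closure (U n))ᶜ) ∧
      (∀ x ∈ (closure (U n))ᶜ, ∃ t : ℝ≥0, 0 < t ∧ 0 < M.killedExp (closure (U n)) φ t x))
    (hτ : ∀ n, 0 < n → ∀ x ∈ (closure (U (n + 1)))ᶜ, ∀ᵐ ω ∂(M.P x),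
      M.hittingTime (closure (U (n + 1))) ω < M.hittingTime (closure (U n)) ω ∧
      M.hittingTime (closure (U n)) ω < ∞)
    {r : ℝ} (hr0 : 0 < r) (hr1 : r < 1) {K : Set S} (hK : IsCompact K)
    (h : ∀ W : Set S, IsCompact W → W ⊆ Kᶜ →
      IntegrableOnCompactsIn m Kᶜ (M.truncResolvent K r W)) :
    ∃ K' : Set S, IsCompact K' ∧ IntegrableOnCompactsIn m K'ᶜ (M.hittingResolvent K' r) := by
  -- The lower bound `1` on `n` passes to `k`, as `hτ` requires a positive index.
  obtain ⟨n, hn, hKn⟩ := exists_ge_subset_of_isCompact hU_mono hU_open hU_cover hK 1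
  obtain ⟨k, hnk, hk⟩ :=
    exists_ge_subset_of_isCompact hU_mono hU_open hU_cover (hU_compact n) n
  obtain ⟨j, hkj, hj⟩ :=
    exists_ge_subset_of_isCompact hU_mono hU_open hU_cover (hU_compact (k + 1)) (k + 1)
  obtain ⟨φ, hφc, hφ0, hφs, hφV, hcont, hpos⟩ := hφ n
  obtain ⟨C, hC⟩ := hφc.bounded_above_of_compact_support hφs
  have hKV : K ⊆ closure (U n) := hKn.trans subset_closure
  have hcl : ∀ {a b : ℕ}, a ≤ b → closure (U a) ⊆ closure (U b) := fun hab =>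
    closure_mono (hU_mono hab)
  have hB : IsCompact (closure (U j) \ U k) := (hU_compact j).diff (hU_open k)
  obtain ⟨δ, hδ0, hδt, hδ⟩ := hM.exists_pos_le_truncResolvent isClosed_closure hφc hφ0 hC
    hcont hpos hr0 hB fun y hy hyn => hy.2 (hk hyn)
  have hW : MeasurableSet (tsupport φ) := (isClosed_tsupport φ).measurableSet
  let c := ∫⁻ t in Iio (0 : ℝ), ENNReal.ofReal (r ^ (-t))
  have hc : c < ∞ := lintegral_rpow_neg_Iio_lt_top hr0 hr1
  have hmain : ∀ x ∈ (closure (U j))ᶜ, M.hittingResolvent (closure (U j)) r x ≤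
      δ⁻¹ * c * M.truncResolvent K r (tsupport φ) x := by
    intro x hx
    have hxk : x ∈ (closure (U (k + 1)))ᶜ := fun hxk => hx (hcl hkj hxk)
    have hae : ∀ᵐ ω ∂(M.P x), M.hittingTime (U j) ω < M.hittingTime (closure (U k)) ω := by
      filter_upwards [hτ k (by omega) x hxk] with ω hω
      exact (M.hittingTime_anti hj ω).trans_lt hω.1
    have hlt : ∀ᵐ ω ∂(M.P x), M.hittingTime (U j) ω < M.hittingTime (closure (U n)) ω := by
      filter_upwards [hae] with ω hω
      exact hω.trans_le (M.hittingTime_anti (hcl hnk) ω)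
    have hδx : ∀ᵐ ω ∂(M.P x), ∀ t : ℝ≥0, M.hittingTime (U j) ω = t →
        δ ≤ M.truncResolvent (closure (U n)) r (tsupport φ) (M.X t ω) := by
      filter_upwards [hae, M.start x] with ω hω h0 t ht
      have hmem := M.X_mem_closure_of_hittingTime_eq ht
      -- Entry at time `0` would put the starting point `x` in `closure (U j)`.
      have ht0 : 0 < t := by
        refine pos_iff_ne_zero.2 fun h => hx ?_
        rwa [h, h0] at hmem
      refine hδ _ ⟨hmem, fun hk' => ?_⟩
      exact M.X_notMem_of_lt_hittingTime ht0 (ht ▸ hω) (subset_closure hk')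
    have hle := hM.mul_hittingResolvent_le isClosed_closure hW (hU_open j) hr0 hδt hlt hδx
    have hanti : M.hittingResolvent (closure (U j)) r x ≤ M.hittingResolvent (U j) r x := by
      rw [hittingResolvent_eq, hittingResolvent_eq]
      exact truncResolvent_mono subset_closure subset_rfl r x
    calc M.hittingResolvent (closure (U j)) r x
        ≤ δ⁻¹ * (δ * M.hittingResolvent (U j) r x) := by
          rwa [← mul_assoc, ENNReal.inv_mul_cancel hδ0 hδt, one_mul]
      _ ≤ δ⁻¹ * (c * M.truncResolvent K r (tsupport φ) x) := by
          refine mul_le_mul_right (hle.trans ?_) _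
          exact mul_le_mul_right (truncResolvent_mono hKV subset_rfl r x) _
      _ = _ := (mul_assoc _ _ _).symm
  refine ⟨closure (U j), hU_compact j, fun D hD hDj => ⟨?_, ?_⟩⟩
  · rw [hittingResolvent_eq]
    exact (hM.measurable_truncResolvent isClosed_closure .univ r).aemeasurable
  · have hint := (h (tsupport φ) hφs (hφV.trans (compl_subset_compl.2 hKV)) D hD
      (hDj.trans (compl_subset_compl.2 (hKV.trans (hcl (by omega)))))).2
    have hct : δ⁻¹ * c ≠ ∞ := ENNReal.mul_ne_top (ENNReal.inv_ne_top.2 hδ0) hc.ne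
    refine (setLIntegral_mono' hD.isClosed.measurableSet fun x hx => hmain x (hDj hx)).trans_lt ?_
    rw [lintegral_const_mul' _ _ hct]
    exact ENNReal.mul_lt_top hct.lt_top hint

end StrongMarkovProcess

theorem proposition3 {d : ℕ} (E : Set (EuclideanSpace ℝ (Fin d)))
    (hE_closed : IsClosed E) (hE_unbounded : ¬ Bornology.IsBounded E)
    (m : Measure E) [IsFiniteMeasureOnCompacts m] [m.IsOpenPosMeasure]
    {Ω : Type*} [MeasurableSpace Ω] (M : StrongMarkovProcess Ω E)
    (hM : M.MeasurableHitting)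
    (U : ℕ → Set E) (hU_mono : Monotone U) (hU_open : ∀ n, IsOpen (U n))
    (hU_compact : ∀ n, IsCompact (closure (U n))) (hU_cover : ⋃ n, U n = univ)
    (hφ : ∀ n, ∃ φ : E → ℝ, Continuous φ ∧ (∀ x, 0 ≤ φ x) ∧
      HasCompactSupport φ ∧ tsupport φ ⊆ (closure (U n))ᶜ ∧
      (∀ t : ℝ≥0, 0 < t →
        ContinuousOn (fun x => M.killedExp (closure (U n)) φ t x) (closure (U n))ᶜ) ∧
      (∀ x ∈ (closure (U n))ᶜ, ∃ t : ℝ≥0, 0 < t ∧ 0 < M.killedExp (closure (U n)) φ t x))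
    (hτ : ∀ n, 0 < n → ∀ x ∈ (closure (U (n + 1)))ᶜ, ∀ᵐ ω ∂(M.P x),
      M.hittingTime (closure (U (n + 1))) ω < M.hittingTime (closure (U n)) ω ∧
      M.hittingTime (closure (U n)) ω < ∞) :
    M.essentialSpectralRadius m = M.returnRate m := by

  let R : Set ℝ := {r | 0 < r ∧ ∃ K : Set E, IsCompact K ∧
    ∀ W : Set E, IsCompact W → W ⊆ Kᶜ → IntegrableOnCompactsIn m Kᶜ (M.truncResolvent K r W)}
  let Q : Set ℝ := {r | 0 < r ∧ ∃ K : Set E, IsCompact K ∧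
    IntegrableOnCompactsIn m Kᶜ (M.hittingResolvent K r)}
  change sInf R = sInf Q
  have hsub : Q ⊆ R := fun r ⟨hr, K, hK, h⟩ => ⟨hr, K, hK, fun W hW _ =>
    hM.integrableOnCompactsIn_truncResolvent hK.isClosed hW.isClosed.measurableSet h⟩
  have hgt : ∀ r : ℝ, 1 < r → r ∈ Q := fun r hr =>
    ⟨by linarith, ∅, isCompact_empty,
      hM.integrableOnCompactsIn_hittingResolvent_of_one_lt m isClosed_empty hr _⟩
  have hbdR : BddBelow R := ⟨0, fun r hr => hr.1.le⟩
  have hbdS : BddBelow Q := hbdR.mono hsub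
  have hne : Q.Nonempty := ⟨2, hgt 2 one_lt_two⟩
  refine le_antisymm (csInf_le_csInf hbdR hne hsub) (le_csInf (hne.mono hsub) ?_)
  rintro r ⟨hr0, K, hK, h⟩
  rcases lt_or_ge r 1 with hr1 | hr1
  · exact csInf_le hbdS ⟨hr0, hM.exists_integrableOnCompactsIn_hittingResolvent m U hU_mono hU_open
      hU_compact hU_cover hφ hτ hr0 hr1 hK h⟩
  -- All `r' > 1` lie in `Q`, so `sInf Q ≤ 1 ≤ r`.
  · exact le_of_forall_gt_imp_ge_of_dense fun r' hr' =>
      csInf_le hbdS (hgt r' (hr1.trans_lt hr'))
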